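/- Let $p>3$ be a prime. Then $$\sum_{k=0}^{(p-1)/2}\frac{3k+1}{16^k}\binom{2k}{k}^3\equiv p+2\left(\frac{-1}{p}\right)p^3E_{p-3}\pmod{p^4},$$ where $\left(\frac{\cdot}{p}\right)$ denotes the Legendre symbol and $E_0,E_1,E_2,\dots$ are the Euler numbers, i.e. the integers defined by $E_0=1$ and $\sum_{0\le j\le n,\ 2\mid n-j}\binom{n}{j}E_j=0$ for all $n\ge 1$ (equivalently, $\frac{2e^x}{e^{2x}+1}=\sum_{n\ge 0}E_n\frac{x^n}{n!}$). Here, for rational numbers $a,b$, $a\equiv b\pmod{p^4}$ means that $(a-b)/p^4$ is a rational number whose denominator is not divisible by $p$. -/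

import Mathlib

/-- The Euler numbers `1, 0, -1, 0, 5, 0, -61, 0, 1385, …` (the coefficients in
`2 eˣ / (e²ˣ + 1) = ∑ Eₙ xⁿ / n!`), given by their usual recursion `E₀ = 1` and, for `n ≥ 1`,
`∑ (n choose j) Eⱼ = 0`, the sum being over all `0 ≤ j ≤ n` with `n - j` even. -/
def eulerNumber : ℕ → ℤ
  | 0 => 1
  | n + 1 => -∑ j : Fin (n + 1),
      if Even (n + 1 - (j : ℕ)) then ((n + 1).choose j : ℤ) * eulerNumber j else 0
  decreasing_by exact j.2

/-- Congruence of rational numbers modulo an integer `m`: the difference is `m` times a rational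
number whose denominator is prime to `m`. -/
def RatModEq (m : ℕ) (x y : ℚ) : Prop :=
  ∃ c : ℚ, c.den.Coprime m ∧ x - y = (m : ℚ) * c

/-! Write p = 2n + 1. The sum has a closed form: it equals p · C(2n, n) · A / 16 ^ n, where A is
`alternatingChooseSq n`. The explicit factor p means that modulo p ^ 3 suffices for the other two.
Morley's congruence gives (-1) ^ n C(2n, n) ≡ 16 ^ n. For A, up to the sign (-1) ^ n it is ∑ (-1) ^
j C(p, j) ^ 2 over j ≤ n. The term j = 0 is 1 and the others are p ^ 2 / j ^ 2 up to sign, modulo p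
^ 3, so what remains is an alternating sum of 1 / j ^ 2 ≡ j ^ (p - 3) modulo p, which Euler
polynomials evaluate. -/

/-! ### Euler numbers and alternating power sums -/

/-- The polynomial `∑ (m choose j) Eⱼ x ^ (m - j)`, a rescaled Euler polynomial. -/
def eulerPoly {R : Type*} [CommRing R] (m : ℕ) (x : R) : R :=
  ∑ j ∈ Finset.range (m + 1), (m.choose j : R) * (eulerNumber j : R) * x ^ (m - j)

theorem sum_choose_mul_eulerNumber (n : ℕ) :
    ∑ j ∈ Finset.range (n + 1), (if Even (n - j) then (n.choose j : ℤ) * eulerNumber j else 0) =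
      if n = 0 then 1 else 0 := by
  cases n with
  | zero => simp [eulerNumber]
  | succ n =>
    rw [Finset.sum_range_succ, eulerNumber, Finset.sum_range]
    simp

theorem eulerNumber_of_odd (n : ℕ) (hn : Odd n) : eulerNumber n = 0 := by
  induction n using Nat.strong_induction_on with
  | _ n ih =>
    have h := sum_choose_mul_eulerNumber n
    rw [Finset.sum_range_succ, Finset.sum_eq_zero] at h
    · have h0 : n ≠ 0 := by rintro rfl; simp at hn
      simpa [h0] using h
    · intro j hj
      have hj' := Finset.mem_range.1 hj
      split_ifs with he
      · rw [ih j hj' (by rw [Nat.even_sub hj'.le] at he; grind), mul_zero]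
      · rfl

/-- The coefficient of x ^ i on the left is 2 C(m, i) times the defining recursion of the Euler
numbers at m - i, which vanishes unless i = m. -/
theorem eulerPoly_add_one_add_sub_one {R : Type*} [CommRing R] (m : ℕ) (x : R) :
    eulerPoly m (x + 1) + eulerPoly m (x - 1) = 2 * x ^ m := by
  have key : ∀ j ∈ Finset.range (m + 1),
      (m.choose j : R) * (eulerNumber j : R) * (x + 1) ^ (m - j) +
        (m.choose j : R) * (eulerNumber j : R) * (x - 1) ^ (m - j) =
      ∑ i ∈ Finset.range (m + 1), 2 * (m.choose i : R) * x ^ i *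
        (if j ≤ m - i then
          (((if Even (m - i - j) then ((m - i).choose j : ℤ) * eulerNumber j else 0 : ℤ)) : R)
          else 0) := by
    intro j hj
    have hj' : j ≤ m := by simpa [Nat.lt_succ_iff] using hj
    rw [sub_eq_add_neg, add_pow, add_pow, ← mul_add, ← Finset.sum_add_distrib, Finset.mul_sum]
    rw [← Finset.sum_subset (Finset.range_mono (by omega : m - j + 1 ≤ m + 1))]
    · refine Finset.sum_congr rfl fun i hi => ?_
      have hi' : i ≤ m - j := by simpa [Nat.lt_succ_iff] using hi
      have hc : m.choose j * (m - j).choose i = m.choose i * (m - i).choose j := by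
        have h1 := Nat.choose_mul (n := m) (k := i + j) (s := j) (by omega)
        have h2 := Nat.choose_mul (n := m) (k := i + j) (s := i) (by omega)
        have h3 : (i + j).choose j = (i + j).choose i := by
          rw [← Nat.choose_symm (by omega : j ≤ i + j)]; congr 1; omega
        rw [h3, h2] at h1
        simpa using h1.symm
      have hc' : (m.choose j : R) * ((m - j).choose i : R) =
          (m.choose i : R) * ((m - i).choose j : R) := by
        rw [← Nat.cast_mul, ← Nat.cast_mul, hc]
      rw [if_pos (by omega), (by omega : m - i - j = m - j - i)]
      split_ifs with he
      · rw [he.neg_one_pow]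
        push_cast
        linear_combination (2 * x ^ i * (eulerNumber j : R)) * hc'
      · rw [(Nat.not_even_iff_odd.1 he).neg_one_pow]
        push_cast
        ring
    · intro i _ hi
      have : m - j < i := by simpa using hi
      rw [if_neg (by simp at *; omega), mul_zero]
  rw [eulerPoly, eulerPoly, ← Finset.sum_add_distrib, Finset.sum_congr rfl key, Finset.sum_comm]
  simp_rw [← Finset.mul_sum]
  have hin : ∀ i ∈ Finset.range (m + 1),
      2 * (m.choose i : R) * x ^ i * ∑ j ∈ Finset.range (m + 1), (if j ≤ m - i then
          (((if Even (m - i - j) then ((m - i).choose j : ℤ) * eulerNumber j else 0 : ℤ)) : R)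
          else 0) = if i = m then 2 * x ^ m else 0 := by
    intro i hi
    have hi' : i ≤ m := by simpa [Nat.lt_succ_iff] using hi
    rw [← Finset.sum_subset (Finset.range_mono (by omega : m - i + 1 ≤ m + 1))]
    · rw [Finset.sum_congr rfl (g := fun j => (((if Even (m - i - j) then
        ((m - i).choose j : ℤ) * eulerNumber j else 0 : ℤ)) : R))
        (fun j hj => if_pos (by simpa [Nat.lt_succ_iff] using hj)),
        ← Int.cast_sum, sum_choose_mul_eulerNumber]
      rcases eq_or_lt_of_le hi' with rfl | h
      · simp
      · rw [if_neg (by omega), if_neg h.ne]; simp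
    · intro j _ hj
      exact if_neg (by simpa using hj)
  rw [Finset.sum_congr rfl hin]
  simp

theorem eulerPoly_one {R : Type*} [CommRing R] (m : ℕ) (hm : Even m) (h0 : m ≠ 0) :
    eulerPoly m (1 : R) = 0 := by
  have h := sum_choose_mul_eulerNumber m
  rw [if_neg h0] at h
  have h' := congrArg (Int.cast : ℤ → R) h
  rw [Int.cast_zero, Int.cast_sum] at h'
  rw [eulerPoly, ← h']
  refine Finset.sum_congr rfl fun j hj => ?_
  have hj' : j ≤ m := by simpa [Nat.lt_succ_iff] using hj
  split_ifs with he
  · push_cast; ring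
  · rw [eulerNumber_of_odd j (by rw [Nat.even_sub hj'] at he; grind)]
    simp

theorem eulerPoly_zero {R : Type*} [CommRing R] (m : ℕ) :
    eulerPoly m (0 : R) = eulerNumber m := by
  rw [eulerPoly, Finset.sum_range_succ, Finset.sum_eq_zero]
  · simp
  · intro j hj
    rw [zero_pow (by have := Finset.mem_range.1 hj; omega), mul_zero]

theorem sum_neg_one_pow_mul_eulerPoly {R : Type*} [CommRing R] (m n : ℕ) :
    ∑ k ∈ Finset.range n, (-1) ^ (k + 1) * (2 * (2 * ((k + 1 : ℕ) : R)) ^ m) =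
      (-1) ^ n * eulerPoly m (2 * (n : R) + 1) - eulerPoly m (1 : R) := by
  induction n with
  | zero => simp
  | succ n ih =>
    rw [Finset.sum_range_succ, ih, ← eulerPoly_add_one_add_sub_one]
    push_cast
    rw [show 2 * ((n : R) + 1) - 1 = 2 * n + 1 by ring]
    ring

/-- The alternating sum of `k ^ (p - 3)` over the first half of the residues. -/
theorem sum_neg_one_pow_mul_pow_eq_eulerNumber (n : ℕ) [Fact (2 * n + 1).Prime] (hn : 1 < n) :
    ∑ k ∈ Finset.range n, (-1) ^ (k + 1) * ((k + 1 : ℕ) : ZMod (2 * n + 1)) ^ (2 * n - 2) =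
      2 * (-1) ^ n * (eulerNumber (2 * n - 2) : ZMod (2 * n + 1)) := by
  -- The telescoped sum ends at 2n + 1 = p ≡ 0, where the polynomial is the Euler number; the other
  -- end, at 1, vanishes.
  have h := sum_neg_one_pow_mul_eulerPoly (R := ZMod (2 * n + 1)) (2 * n - 2) n
  have hp : (2 * (n : ZMod (2 * n + 1)) + 1) = 0 := by
    exact_mod_cast ZMod.natCast_self (2 * n + 1)
  rw [hp, eulerPoly_zero, eulerPoly_one _ ⟨n - 1, by omega⟩ (by omega), sub_zero] at h
  have h2 : (2 : ZMod (2 * n + 1)) ≠ 0 := by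
    intro h2
    have : ((2 : ℕ) : ZMod (2 * n + 1)) = 0 := by exact_mod_cast h2
    rw [ZMod.natCast_eq_zero_iff] at this
    have := Nat.le_of_dvd (by norm_num) this
    omega
  have hf : (2 : ZMod (2 * n + 1)) ^ (2 * n - 2) * 4 = 1 := by
    rw [show (4 : ZMod (2 * n + 1)) = 2 ^ 2 by norm_num, ← pow_add,
      show 2 * n - 2 + 2 = 2 * n + 1 - 1 by omega]
    exact ZMod.pow_card_sub_one_eq_one h2
  have hs : ∑ k ∈ Finset.range n, (-1) ^ (k + 1) *
        (2 * (2 * ((k + 1 : ℕ) : ZMod (2 * n + 1))) ^ (2 * n - 2)) =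
      2 * 2 ^ (2 * n - 2) * ∑ k ∈ Finset.range n,
        (-1) ^ (k + 1) * ((k + 1 : ℕ) : ZMod (2 * n + 1)) ^ (2 * n - 2) := by
    rw [Finset.mul_sum]
    refine Finset.sum_congr rfl fun k _ => ?_
    rw [mul_pow]; ring
  rw [hs] at h
  linear_combination 2 * h - (∑ k ∈ Finset.range n,
        (-1) ^ (k + 1) * ((k + 1 : ℕ) : ZMod (2 * n + 1)) ^ (2 * n - 2)) * hf

/-! ### Closed form of the sum -/

/-- The alternating sum of the squares of the entries `0, …, n` of row `2 n + 1` of Pascal's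
triangle, starting from the middle. -/
def alternatingChooseSq (n : ℕ) : ℤ :=
  ∑ k ∈ Finset.range (n + 1), (-1) ^ k * ((2 * n + 1).choose (n + 1 + k) : ℤ) ^ 2

/-- A certificate in the style of Zeilberger: the right side is r k + r (k + 1), so the alternating
sum over k telescopes and yields a first-order recurrence. All binomials are rational multiples of
C(2m + 2, m + 1 + k). -/
theorem choose_sq_telescope (m k : ℕ) (hk : k ≤ m + 1) :
    (2 * (m : ℚ) + 3) * ((2 * (m + 1) + 1).choose (m + 1 + 1 + k) : ℚ) ^ 2 -
        8 * ((m : ℚ) + 1) * ((2 * m + 1).choose (m + 1 + k) : ℚ) ^ 2 =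
      (3 * (m : ℚ) + 4 - (k : ℚ) ^ 2 / (m + 1)) * ((2 * m + 2).choose (m + 1 + k) : ℚ) ^ 2 +
      (3 * (m : ℚ) + 4 - ((k + 1 : ℕ) : ℚ) ^ 2 / (m + 1)) *
        ((2 * m + 2).choose (m + 1 + (k + 1)) : ℚ) ^ 2 := by
  have h1 : ((2 * (m + 1) + 1).choose (m + 1 + 1 + k) : ℚ) =
      (2 * m + 3) / (m + 2 + k) * ((2 * m + 2).choose (m + 1 + k) : ℚ) := by
    have := Nat.add_one_mul_choose_eq (2 * m + 2) (m + 1 + k)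
    rw [show m + 1 + 1 + k = m + 1 + k + 1 by ring]
    have h' : (2 * (m : ℚ) + 2 + 1) * ((2 * m + 2).choose (m + 1 + k) : ℚ) =
      ((2 * m + 2 + 1).choose (m + 1 + k + 1) : ℚ) * (m + 1 + k + 1) := by exact_mod_cast this
    rw [show 2 * (m + 1) + 1 = 2 * m + 2 + 1 by ring]
    field_simp
    linarith
  have h2 : ((2 * m + 2).choose (m + 1 + (k + 1)) : ℚ) =
      (m + 1 - k) / (m + 2 + k) * ((2 * m + 2).choose (m + 1 + k) : ℚ) := by
    have := Nat.choose_succ_right_eq (2 * m + 2) (m + 1 + k)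
    rw [show 2 * m + 2 - (m + 1 + k) = m + 1 - k by omega] at this
    have h' := congrArg (Nat.cast : ℕ → ℚ) this
    push_cast [Nat.cast_sub hk] at h'
    rw [← add_assoc (m + 1)]
    field_simp
    linarith
  have h3 : ((2 * m + 1).choose (m + 1 + k) : ℚ) =
      (m + 1 - k) / (2 * (m + 1)) * ((2 * m + 2).choose (m + 1 + k) : ℚ) := by
    have := Nat.choose_mul_succ_eq (2 * m + 1) (m + 1 + k)
    rw [show 2 * m + 1 + 1 - (m + 1 + k) = m + 1 - k by omega] at this
    have h' := congrArg (Nat.cast : ℕ → ℚ) this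
    push_cast [Nat.cast_sub hk] at h'
    rw [show 2 * m + 1 + 1 = 2 * m + 2 by ring] at h'
    field_simp
    linarith
  rw [h1, h2, h3]
  push_cast
  have : (m : ℚ) + 2 + k ≠ 0 := by positivity
  field_simp
  ring

theorem alternating_sum_add_succ {R : Type*} [CommRing R] (r : ℕ → R) (n : ℕ) :
    ∑ k ∈ Finset.range n, (-1) ^ k * (r k + r (k + 1)) = r 0 - (-1) ^ n * r n := by
  induction n with
  | zero => simp
  | succ n ih => rw [Finset.sum_range_succ, ih]; ring

theorem alternatingChooseSq_succ (m : ℕ) :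
    (2 * (m : ℚ) + 3) * alternatingChooseSq (m + 1) =
      8 * ((m : ℚ) + 1) * alternatingChooseSq m +
        (3 * (m : ℚ) + 4) * ((2 * (m + 1)).choose (m + 1) : ℚ) ^ 2 := by
  -- With m + 2 terms the upper boundary term vanishes; r 0 is the inhomogeneous term.
  have h := alternating_sum_add_succ (fun k : ℕ => (3 * (m : ℚ) + 4 - (k : ℚ) ^ 2 / (m + 1)) *
    ((2 * m + 2).choose (m + 1 + k) : ℚ) ^ 2) (m + 2)
  rw [Finset.sum_congr rfl fun k hk => by
    rw [← choose_sq_telescope m k (by have := Finset.mem_range.1 hk; omega)]] at h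
  have hz : (2 * m + 2).choose (m + 1 + (m + 2)) = 0 := Nat.choose_eq_zero_of_lt (by omega)
  have hz' : (2 * m + 1).choose (m + 1 + (m + 1)) = 0 := Nat.choose_eq_zero_of_lt (by omega)
  have e1 : (alternatingChooseSq m : ℚ) =
      ∑ k ∈ Finset.range (m + 2), (-1) ^ k * ((2 * m + 1).choose (m + 1 + k) : ℚ) ^ 2 := by
    rw [Finset.sum_range_succ, hz', alternatingChooseSq]
    push_cast
    simp
  have e2 : (alternatingChooseSq (m + 1) : ℚ) = ∑ k ∈ Finset.range (m + 2),
      (-1) ^ k * ((2 * (m + 1) + 1).choose (m + 1 + 1 + k) : ℚ) ^ 2 := by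
    rw [alternatingChooseSq]
    push_cast
    rfl
  have hs : ∑ k ∈ Finset.range (m + 2), (-1) ^ k *
      ((2 * (m : ℚ) + 3) * ((2 * (m + 1) + 1).choose (m + 1 + 1 + k) : ℚ) ^ 2 -
        8 * ((m : ℚ) + 1) * ((2 * m + 1).choose (m + 1 + k) : ℚ) ^ 2) =
      (2 * (m : ℚ) + 3) * alternatingChooseSq (m + 1) -
        8 * ((m : ℚ) + 1) * alternatingChooseSq m := by
    rw [e1, e2, Finset.mul_sum, Finset.mul_sum, ← Finset.sum_sub_distrib]
    exact Finset.sum_congr rfl fun k _ => by ring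
  rw [hs, hz] at h
  rw [mul_add 2 m 1]
  simp at h ⊢
  linarith

/-- Closed form of the partial sums of the divergent series `∑ (3 k + 1) (2k choose k)³ / 16 ^ k`. -/
theorem sum_three_mul_add_one_mul_choose_cube (n : ℕ) :
    ∑ k ∈ Finset.range (n + 1), (3 * (k : ℚ) + 1) / 16 ^ k * ((2 * k).choose k : ℚ) ^ 3 =
      (2 * n + 1) * ((2 * n).choose n : ℚ) * alternatingChooseSq n / 16 ^ n := by
  induction n with
  | zero => simp [alternatingChooseSq]
  | succ n ih =>
    rw [Finset.sum_range_succ, ih]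
    have h := alternatingChooseSq_succ n
    have hc : ((n : ℚ) + 1) * ((2 * (n + 1)).choose (n + 1) : ℚ) =
        2 * (2 * n + 1) * ((2 * n).choose n : ℚ) := by
      exact_mod_cast Nat.succ_mul_centralBinom_succ n
    push_cast
    rw [pow_succ]
    field_simp
    linear_combination (-((2 * (n + 1)).choose (n + 1) : ℚ)) * h -
      8 * (alternatingChooseSq n : ℚ) * hc

/-! ### Morley's congruence -/

/-- Newton's identity e₁ ^ 2 - 2 e₂ = p₂ for the reciprocals of the `a j`: b and c are -e₁ and e₂
times the product. -/
theorem exists_prod_sub_expansion {K : Type*} [Field K] (a : ℕ → ℤ) (n : ℕ)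
    (ha : ∀ j < n, (a j : K) ≠ 0) :
    ∃ b c : ℤ, (∀ x : ℤ, ∃ q : ℤ, ∏ j ∈ Finset.range n, (a j - x) =
        ∏ j ∈ Finset.range n, a j + b * x + c * x ^ 2 + x ^ 3 * q) ∧
      (b : K) ^ 2 - 2 * ((∏ j ∈ Finset.range n, a j : ℤ) : K) * c =
        ((∏ j ∈ Finset.range n, a j : ℤ) : K) ^ 2 *
          ∑ j ∈ Finset.range n, ((a j : K)⁻¹) ^ 2 := by
  induction n with
  | zero => exact ⟨0, 0, fun x => ⟨0, by simp⟩, by simp⟩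
  | succ n ih =>
    obtain ⟨b, c, h1, h2⟩ := ih fun j hj => ha j (by omega)
    refine ⟨b * a n - ∏ j ∈ Finset.range n, a j, c * a n - b, fun x => ?_, ?_⟩
    · obtain ⟨q, hq⟩ := h1 x
      refine ⟨q * (a n - x) - c, ?_⟩
      rw [Finset.prod_range_succ, Finset.prod_range_succ, hq]
      ring
    · rw [Finset.prod_range_succ, Finset.sum_range_succ]
      have hn := ha n (by omega)
      have hc : (a n : K) ^ 2 * (a n : K)⁻¹ ^ 2 = 1 := by
        rw [← mul_pow, mul_inv_cancel₀ hn, one_pow]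
      push_cast at h2 ⊢
      linear_combination (a n : K) ^ 2 * h2 - (∏ j ∈ Finset.range n, (a j : K)) ^ 2 * hc

theorem natCast_ne_zero_of_lt (p j : ℕ) (h0 : 0 < j) (hj : j < p) :
    (j : ZMod p) ≠ 0 := by
  intro h
  rw [ZMod.natCast_eq_zero_iff] at h
  exact absurd (Nat.le_of_dvd h0 h) (by omega)

/-- The even power is invariant under j ↦ p - j, so this is half of a vanishing full power sum. -/
theorem sum_range_half_pow_eq_zero (n m : ℕ) [Fact (2 * n + 1).Prime] (hm : Even m) (h0 : 0 < m)
    (hlt : m < 2 * n) :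
    ∑ j ∈ Finset.range n, ((j + 1 : ℕ) : ZMod (2 * n + 1)) ^ m = 0 := by
  have hsum : ∑ x : ZMod (2 * n + 1), x ^ m = 0 :=
    FiniteField.sum_pow_lt_card_sub_one _ m (by rw [ZMod.card]; omega)
  have hrange : ∑ x : ZMod (2 * n + 1), x ^ m =
      ∑ j ∈ Finset.range (2 * n + 1), (j : ZMod (2 * n + 1)) ^ m := by
    rw [Finset.sum_range]
    exact Finset.sum_congr rfl fun x _ => by
      congr 1
      exact (ZMod.natCast_zmod_val x).symm
  have hrefl : ∑ j ∈ Finset.range n, ((n + j + 1 : ℕ) : ZMod (2 * n + 1)) ^ m =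
      ∑ j ∈ Finset.range n, ((j + 1 : ℕ) : ZMod (2 * n + 1)) ^ m := by
    rw [← Finset.sum_range_reflect]
    refine Finset.sum_congr rfl fun j hj => ?_
    have hj' := Finset.mem_range.1 hj
    have : ((n + (n - 1 - j) + 1 : ℕ) : ZMod (2 * n + 1)) = -((j + 1 : ℕ) : ZMod (2 * n + 1)) := by
      rw [eq_neg_iff_add_eq_zero, ← Nat.cast_add,
        show n + (n - 1 - j) + 1 + (j + 1) = 2 * n + 1 by omega]
      exact ZMod.natCast_self _
    rw [this, hm.neg_pow]
  have hsplit (f : ℕ → ZMod (2 * n + 1)) : ∑ j ∈ Finset.range (2 * n), f j =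
      ∑ j ∈ Finset.range n, f j + ∑ j ∈ Finset.range n, f (n + j) := by
    rw [← Finset.sum_range_add, ← two_mul]
  rw [hrange, Finset.sum_range_succ', hsplit, hrefl, Nat.cast_zero, zero_pow h0.ne', add_zero,
    ← two_mul] at hsum
  refine (mul_eq_zero.1 hsum).resolve_left ?_
  exact_mod_cast natCast_ne_zero_of_lt (2 * n + 1) 2 (by norm_num) (by omega)

theorem inv_sq_eq_pow (n j : ℕ) [Fact (2 * n + 1).Prime] (hn : 1 < n) (h0 : 0 < j)
    (hj : j < 2 * n + 1) :
    ((j : ZMod (2 * n + 1))⁻¹) ^ 2 = (j : ZMod (2 * n + 1)) ^ (2 * n - 2) := by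
  have h := natCast_ne_zero_of_lt (2 * n + 1) j h0 hj
  rw [inv_pow, inv_eq_iff_eq_inv, eq_comm, inv_eq_iff_eq_inv, eq_comm]
  refine inv_eq_of_mul_eq_one_left ?_
  rw [← pow_add, show 2 * n - 2 + 2 = 2 * n + 1 - 1 by omega]
  exact ZMod.pow_card_sub_one_eq_one h

theorem prod_two_mul_sub (n : ℕ) :
    (∏ j ∈ Finset.range n, ((2 * (j + 1) : ℤ) - (2 * n + 1))) * 2 ^ n =
      (-1) ^ n * ((2 * n).choose n) * n.factorial := by
  have hodd : ∀ n : ℕ, (∏ j ∈ Finset.range n, (2 * (j : ℤ) + 1)) * 2 ^ n =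
      ((2 * n).choose n) * n.factorial := by
    intro n
    induction n with
    | zero => simp
    | succ n ih =>
      have hc : ((n : ℤ) + 1) * ((2 * (n + 1)).choose (n + 1) : ℤ) =
          2 * (2 * n + 1) * ((2 * n).choose n : ℤ) := by
        exact_mod_cast Nat.succ_mul_centralBinom_succ n
      rw [Finset.prod_range_succ, Nat.factorial_succ]
      push_cast
      linear_combination 2 * (2 * (n : ℤ) + 1) * ih - (n.factorial : ℤ) * hc
  rw [mul_assoc, ← hodd, ← mul_assoc, ← Finset.prod_range_reflect (fun j : ℕ => 2 * (j : ℤ) + 1)]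
  congr 1
  rw [← Finset.card_range n, ← Finset.prod_const, Finset.card_range, ← Finset.prod_mul_distrib]
  refine Finset.prod_congr rfl fun j hj => ?_
  have hj' := Finset.mem_range.1 hj
  obtain ⟨i, rfl⟩ := Nat.exists_eq_add_of_lt hj'
  rw [show j + i + 1 - 1 - j = i by omega]
  push_cast
  ring

theorem prod_two_mul_sub_two_mul (n : ℕ) :
    ∏ j ∈ Finset.range n, ((2 * (j + 1) : ℤ) - 2 * (2 * n + 1)) =
      2 ^ n * ((-1) ^ n * ((2 * n).choose n) * n.factorial) := by
  have h : ((2 * n).choose n : ℤ) * n.factorial = ∏ j ∈ Finset.range n, ((2 * n : ℤ) - j) := by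
    rw [mul_comm, ← Nat.cast_mul, ← Nat.descFactorial_eq_factorial_mul_choose,
      Nat.descFactorial_eq_prod_range, Nat.cast_prod]
    refine Finset.prod_congr rfl fun j hj => ?_
    have hj' := Finset.mem_range.1 hj
    rw [Nat.cast_sub (by omega)]
    push_cast
    rfl
  have hconst : ∏ _j ∈ Finset.range n, (2 * (-1) : ℤ) = (2 * (-1)) ^ n := by simp
  rw [mul_assoc, h, ← mul_assoc, ← mul_pow, ← hconst, ← Finset.prod_mul_distrib]
  exact Finset.prod_congr rfl fun j _ => by ring

/-- **Morley's congruence**. -/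
theorem morley_congruence (n : ℕ) [hp : Fact (2 * n + 1).Prime] (hn : 1 < n) :
    (2 * n + 1 : ℤ) ^ 3 ∣ (-1) ^ n * ((2 * n).choose n) - 16 ^ n := by
  have ha : ∀ j < n, (((2 * (j + 1) : ℤ)) : ZMod (2 * n + 1)) ≠ 0 := by
    intro j hj
    exact_mod_cast natCast_ne_zero_of_lt (2 * n + 1) (2 * (j + 1)) (by omega) (by omega)
  obtain ⟨b, c, h1, h2⟩ := exists_prod_sub_expansion (fun j => 2 * (j + 1)) n ha
  have hs : ∑ j ∈ Finset.range n, (((2 * (j + 1) : ℤ) : ZMod (2 * n + 1))⁻¹) ^ 2 = 0 := by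
    have : ∀ j ∈ Finset.range n, (((2 * (j + 1) : ℤ) : ZMod (2 * n + 1))⁻¹) ^ 2 =
        ((2 : ZMod (2 * n + 1))⁻¹) ^ 2 * ((j + 1 : ℕ) : ZMod (2 * n + 1)) ^ (2 * n - 2) := by
      intro j hj
      have hj' := Finset.mem_range.1 hj
      rw [← inv_sq_eq_pow n (j + 1) hn (by omega) (by omega), ← mul_pow, ← mul_inv]
      push_cast
      rfl
    rw [Finset.sum_congr rfl this, ← Finset.mul_sum,
      sum_range_half_pow_eq_zero n _ ⟨n - 1, by omega⟩ (by omega) (by omega), mul_zero]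
  rw [hs, mul_zero] at h2
  set A : ℤ := ∏ j ∈ Finset.range n, (2 * ((j : ℤ) + 1)) with hA
  have hd : ((2 * n + 1 : ℕ) : ℤ) ∣ b ^ 2 - 2 * A * c := by
    rw [← ZMod.intCast_zmod_eq_zero_iff_dvd]
    push_cast
    exact h2
  obtain ⟨d, hd⟩ := hd
  push_cast at hd
  obtain ⟨q, hq⟩ := h1 (2 * n + 1)
  obtain ⟨r, hr⟩ := h1 (2 * (2 * n + 1))
  have hA' : A = 2 ^ n * n.factorial := by
    rw [hA, Finset.prod_mul_distrib, Finset.prod_const, Finset.card_range,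
      ← Finset.prod_range_add_one_eq_factorial]
    push_cast
    rfl
  have g1 := prod_two_mul_sub n
  rw [hq] at g1
  rw [prod_two_mul_sub_two_mul] at hr
  set C : ℤ := (-1) ^ n * ((2 * n).choose n)
  set f : ℤ := (n.factorial : ℤ)
  set P : ℤ := 2 * n + 1
  have h16 : (16 : ℤ) ^ n = (2 ^ n) ^ 4 := by rw [← pow_mul, mul_comm n 4, pow_mul]; norm_num
  -- With F(x) = ∏ (2j - x), the value F(P) ^ 2 - F(0) F(2P) is (b ^ 2 - 2Ac) P ^ 2 modulo P ^ 3,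
  -- and P divides b ^ 2 - 2Ac.
  have hmain : P ^ 3 ∣ (C * f ^ 2) * (C - 16 ^ n) := by
    have : (C * f ^ 2) * (C - 16 ^ n) = (2 ^ n) ^ 2 *
        ((A + b * P + c * P ^ 2 + P ^ 3 * q) ^ 2 -
          A * (A + b * (2 * P) + c * (2 * P) ^ 2 + (2 * P) ^ 3 * r)) := by
      rw [← hr, h16, hA']
      rw [hA'] at g1
      linear_combination (-C * f - (2 ^ n * f + b * P + c * P ^ 2 + P ^ 3 * q) * 2 ^ n) * g1
    rw [this]
    refine Dvd.dvd.mul_left ⟨d + 2 * A * q + 2 * b * c + c ^ 2 * P + 2 * b * P * q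
      + 2 * c * P ^ 2 * q + P ^ 3 * q ^ 2 - 8 * A * r, ?_⟩ _
    linear_combination P ^ 2 * hd
  have hPprime : Prime P := by
    have := Nat.prime_iff_prime_int.1 hp.out
    push_cast at this
    exact this
  refine IsCoprime.dvd_of_dvd_mul_left (IsCoprime.pow_left ?_) hmain
  rw [hPprime.coprime_iff_not_dvd]
  have hf : ∀ k < 2 * n + 1, ¬ P ∣ (k.factorial : ℤ) := by
    intro k hk h
    have h' : ((2 * n + 1 : ℕ) : ℤ) ∣ (k.factorial : ℤ) := by push_cast; exact h
    rw [Int.natCast_dvd_natCast, hp.out.dvd_factorial] at h'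
    omega
  have hCf : C * f ^ 2 = (-1) ^ n * ((2 * n).factorial : ℤ) := by
    have := Nat.choose_mul_factorial_mul_factorial (by omega : n ≤ 2 * n)
    rw [show 2 * n - n = n by omega] at this
    rw [← this]
    push_cast
    ring
  rw [hCf]
  intro h
  rcases hPprime.dvd_or_dvd h with h | h
  · exact hPprime.not_isUnit (isUnit_of_dvd_unit h ((isUnit_one.neg).pow n))
  · exact hf _ (by omega) h

/-! ### The alternating sum of squares modulo p ^ 3 -/

theorem choose_prime_sub_one_eq (n j : ℕ) [hp : Fact (2 * n + 1).Prime] (hj : j < 2 * n + 1) :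
    ((2 * n).choose j : ZMod (2 * n + 1)) = (-1) ^ j := by
  induction j with
  | zero => simp
  | succ j ih =>
    have h : (((2 * n + 1).choose (j + 1) : ℕ) : ZMod (2 * n + 1)) = 0 := by
      rw [ZMod.natCast_eq_zero_iff]
      exact hp.out.dvd_choose_self (by omega) hj
    rw [Nat.choose_succ_succ, Nat.cast_add, ih (by omega)] at h
    rw [pow_succ]
    linear_combination h

theorem neg_one_pow_mul_alternatingChooseSq (n : ℕ) :
    (-1) ^ n * alternatingChooseSq n =
      ∑ j ∈ Finset.range (n + 1), (-1) ^ j * ((2 * n + 1).choose j : ℤ) ^ 2 := by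
  rw [alternatingChooseSq, Finset.mul_sum, ← Finset.sum_range_reflect]
  refine Finset.sum_congr rfl fun j hj => ?_
  have hj' : j ≤ n := by simpa [Nat.lt_succ_iff] using hj
  obtain ⟨i, rfl⟩ := Nat.exists_eq_add_of_le hj'
  rw [show j + i + 1 - 1 - j = i by omega, ← Nat.choose_symm (by omega : j ≤ 2 * (j + i) + 1),
    show 2 * (j + i) + 1 - j = j + i + 1 + i by omega, pow_add]
  have : ((-1 : ℤ) ^ i) * (-1) ^ i = 1 := by rw [← mul_pow]; simp
  linear_combination ((-1) ^ j * ((2 * (j + i) + 1).choose (j + i + 1 + i) : ℤ) ^ 2) * this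

theorem alternatingChooseSq_congruence (n : ℕ) [hp : Fact (2 * n + 1).Prime] (hn : 1 < n) :
    (2 * n + 1 : ℤ) ^ 3 ∣ (-1) ^ n * alternatingChooseSq n -
      (1 + 2 * (-1) ^ n * (2 * n + 1) ^ 2 * eulerNumber (2 * n - 2)) := by
  have hd : ∀ j ∈ Finset.range n, ∃ d : ℤ, ((2 * n + 1).choose (j + 1) : ℤ) = (2 * n + 1) * d := by
    intro j hj
    have hj' := Finset.mem_range.1 hj
    have := hp.out.dvd_choose_self (k := j + 1) (by omega) (by omega)
    rw [← Int.natCast_dvd_natCast] at this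
    push_cast at this
    exact this
  choose! d hd using hd
  -- Cancelling p in (j + 1) C(p, j + 1) = p C(p - 1, j) gives (j + 1) d j ≡ (-1) ^ j.
  have hsq : ∀ j ∈ Finset.range n,
      (d j : ZMod (2 * n + 1)) ^ 2 = ((j + 1 : ℕ) : ZMod (2 * n + 1)) ^ (2 * n - 2) := by
    intro j hj
    have hj' := Finset.mem_range.1 hj
    have h1 := Nat.add_one_mul_choose_eq (2 * n) j
    have h2 : ((2 * n + 1 : ℤ)) * ((2 * n).choose j : ℤ) =
        (2 * n + 1) * (d j * ((j + 1 : ℕ) : ℤ)) := by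
      rw [← mul_assoc, ← hd j hj]
      exact_mod_cast h1
    have h3 := mul_left_cancel₀ (by positivity) h2
    have h4 := congrArg (Int.cast : ℤ → ZMod (2 * n + 1)) h3
    rw [Int.cast_mul, Int.cast_natCast, Int.cast_natCast,
      choose_prime_sub_one_eq n j (by omega)] at h4
    have hne := natCast_ne_zero_of_lt (2 * n + 1) (j + 1) (by omega) (by omega)
    rw [← inv_sq_eq_pow n (j + 1) hn (by omega) (by omega), inv_pow]
    refine eq_inv_of_mul_eq_one_left ?_
    rw [← mul_pow, ← h4, ← pow_mul]
    exact (Even.mul_left even_two j).neg_one_pow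
  have hsum : ((2 * n + 1 : ℕ) : ℤ) ∣ ∑ j ∈ Finset.range n, (-1) ^ (j + 1) * d j ^ 2 -
      2 * (-1) ^ n * eulerNumber (2 * n - 2) := by
    rw [← ZMod.intCast_zmod_eq_zero_iff_dvd, Int.cast_sub, sub_eq_zero, Int.cast_sum]
    push_cast
    rw [← sum_neg_one_pow_mul_pow_eq_eulerNumber n hn]
    exact Finset.sum_congr rfl fun j hj => by rw [hsq j hj]
  obtain ⟨e, he⟩ := hsum
  push_cast at he
  refine ⟨e, ?_⟩
  have hB : (-1) ^ n * alternatingChooseSq n =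
      1 + (2 * n + 1) ^ 2 * ∑ j ∈ Finset.range n, (-1) ^ (j + 1) * d j ^ 2 := by
    rw [neg_one_pow_mul_alternatingChooseSq, Finset.sum_range_succ', Finset.mul_sum, add_comm]
    rw [Finset.sum_congr rfl fun j hj => by rw [hd j hj]]
    simp only [pow_zero, Nat.choose_zero_right, Nat.cast_one, one_pow, mul_one]
    congr 1
    exact Finset.sum_congr rfl fun j _ => by ring
  rw [hB]
  linear_combination (2 * (n : ℤ) + 1) ^ 2 * he

/-! ### Combining the congruences -/

theorem theorem1p2 (p : ℕ) [Fact p.Prime] (hp : 3 < p) :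
    RatModEq (p ^ 4)
      (∑ k ∈ Finset.range ((p - 1) / 2 + 1),
        (3 * (k : ℚ) + 1) / 16 ^ k * ((2 * k).choose k : ℚ) ^ 3)
      ((p : ℚ) + 2 * (legendreSym p (-1) : ℚ) * (p : ℚ) ^ 3 * (eulerNumber (p - 3) : ℚ)) := by
  have hpp : p.Prime := Fact.out
  have hodd : p % 2 = 1 := hpp.eq_two_or_odd.resolve_left (by omega)
  have hleg : legendreSym p (-1) = (-1) ^ ((p - 1) / 2) := by
    rw [legendreSym.at_neg_one (by omega), ZMod.χ₄_eq_neg_one_pow hodd]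
    congr 1
    omega
  rw [hleg]
  obtain ⟨n, rfl⟩ : ∃ n, p = 2 * n + 1 := ⟨p / 2, by omega⟩
  have hn : 1 < n := by omega
  rw [show (2 * n + 1 - 1) / 2 = n by omega, show 2 * n + 1 - 3 = 2 * n - 2 by omega,
    sum_three_mul_add_one_mul_choose_cube]
  obtain ⟨u, hu⟩ := morley_congruence n hn
  obtain ⟨v, hv⟩ := alternatingChooseSq_congruence n hn
  have hsq : ((-1 : ℤ) ^ n) * (-1) ^ n = 1 := by rw [← mul_pow]; simp
  have hint : ((2 * n).choose n : ℤ) * alternatingChooseSq n -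
      16 ^ n * (1 + 2 * (-1) ^ n * (2 * n + 1) ^ 2 * eulerNumber (2 * n - 2)) =
      (2 * n + 1) ^ 3 * (u * ((-1) ^ n * alternatingChooseSq n) + 16 ^ n * v) := by
    linear_combination ((-1) ^ n * alternatingChooseSq n) * hu + 16 ^ n * hv -
      ((2 * n).choose n : ℤ) * alternatingChooseSq n * hsq
  -- The denominator divides 16 ^ n, hence is prime to the odd p.
  refine ⟨(u * ((-1) ^ n * alternatingChooseSq n) + 16 ^ n * v : ℤ) / ((16 ^ n : ℕ) : ℤ), ?_, ?_⟩
  · have hden := Rat.den_dvd (u * ((-1) ^ n * alternatingChooseSq n) + 16 ^ n * v : ℤ)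
      ((16 ^ n : ℕ) : ℤ)
    rw [Rat.divInt_eq_div, Int.natCast_dvd_natCast] at hden
    refine Nat.Coprime.coprime_dvd_left hden (Nat.Coprime.pow _ _ ?_)
    rw [show 16 = 2 ^ 4 by norm_num]
    exact Nat.Coprime.pow_left _ (Nat.coprime_two_left.2 ⟨n, rfl⟩)
  · have h := congrArg (Int.cast : ℤ → ℚ) hint
    push_cast at h ⊢
    field_simp
    linear_combination h
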